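/- Let $p$ be a prime and let $\lambda_1\ge\lambda_2\ge\lambda_3\ge 1$ be integers. The total number of subgroups of the group $\mathbb{Z}_{p^{\lambda_1}}\times\mathbb{Z}_{p^{\lambda_2}}\times\mathbb{Z}_{p^{\lambda_3}}$ (where $\mathbb{Z}_n=\mathbb{Z}/n\mathbb{Z}$) is $$\frac{A}{(p^2-1)^2(p-1)},$$ where $$\begin{aligned} A ={}& (\lambda_3+1)(\lambda_1-\lambda_2+1)p^{\lambda_2+\lambda_3+5} + 2(\lambda_3+1)p^{\lambda_2+\lambda_3+4} \\ & - 2(\lambda_3+1)(\lambda_1-\lambda_2)p^{\lambda_2+\lambda_3+3} - 2(\lambda_3+1)p^{\lambda_2+\lambda_3+2} \\ & + (\lambda_3+1)(\lambda_1-\lambda_2-1)p^{\lambda_2+\lambda_3+1} - (\lambda_1+\lambda_2-\lambda_3+3)p^{2\lambda_3+4} \\ & - 2p^{2\lambda_3+3} + (\lambda_1+\lambda_2-\lambda_3-1)p^{2\lambda_3+2} \\ & + (\lambda_1+\lambda_2+\lambda_3+5)p^2 + 2p - (\lambda_1+\lambda_2+\lambda_3+1). \end{aligned}$$ -/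

import Mathlib

/-!
A subgroup `H` of `A × B` is the same thing as a subgroup `L` of `A` (its projection), a subgroup
`K` of `B` (its intersection with `B`) and a homomorphism `L →+ B ⧸ K`
(`graphSubgroup_bijective`). Take `B = ℤ/pᶜ`. Its quotients are the cyclic groups of order
`p ^ j`, `j ≤ c`, once each, and a finite abelian group `L` has as many homomorphisms into such a
quotient as it has elements killed by `p ^ j` (`card_addMonoidHom_of_isAddCyclic`). Hence the number
of subgroups of `A × ℤ/pᶜ` is `∑ j ≤ c, T A (p ^ j)`, where `T A n`, called `torsionSum` below, is
the sum of `|L[n]|` over all subgroups `L` of `A` (`card_addSubgroup_prod_zmod`).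

For `A = ℤ/pᵃ × ℤ/pᵇ` with `b ≥ 1`, a subgroup is either cyclic or contains the group `A[p]` of order
`p ^ 2` (`isAddCyclic_iff_not_nTorsion_le`). Those containing `A[p]` are the preimages of the subgroups
of `A / A[p] ≅ ℤ/pᵃ⁻¹ × ℤ/pᵇ⁻¹`, and they contribute `p ^ 2 * T (A / A[p]) (p ^ (j - 1))`, or
`T (A / A[p]) 1` if `j = 0` (`torsionSum_prime_mul`, `torsionSum_one`). The cyclic subgroups of each
order are counted by their generators (`cyclicCount_mul_totient`). Induction on `b` gives `T A (p ^ j)`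
in closed form for `j ≤ b ≤ a` (`torsionSum_rankTwo`), and the sum over `j ≤ c` telescopes.
-/

/-- The subgroup of elements of `A` killed by `n`. -/
abbrev nTorsion (A : Type*) [AddCommGroup A] (n : ℕ) : AddSubgroup A :=
  (nsmulAddMonoidHom n : A →+ A).ker

theorem mem_nTorsion {A : Type*} [AddCommGroup A] {n : ℕ} {x : A} :
    x ∈ nTorsion A n ↔ n • x = 0 := by
  simp [nTorsion, AddMonoidHom.mem_ker]

/-! ### Subgroups of a product -/

section Goursat

variable {A B : Type*} [AddCommGroup A] [AddCommGroup B]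

/-- The subgroup of `A × B` lying over `L`, with fibre over `a` the coset `φ a` of `K`. -/
def graphSubgroup (L : AddSubgroup A) (K : AddSubgroup B) (φ : L →+ B ⧸ K) :
    AddSubgroup (A × B) where
  carrier := {z | ∃ h : z.1 ∈ L, φ ⟨z.1, h⟩ = (z.2 : B ⧸ K)}
  zero_mem' := ⟨L.zero_mem, φ.map_zero⟩
  add_mem' := by
    rintro ⟨a, b⟩ ⟨a', b'⟩ ⟨h, e⟩ ⟨h', e'⟩
    refine ⟨L.add_mem h h', ?_⟩
    have := φ.map_add ⟨a, h⟩ ⟨a', h'⟩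
    simp only at e e'
    rw [e, e'] at this
    simpa using this
  neg_mem' := by
    rintro ⟨a, b⟩ ⟨h, e⟩
    refine ⟨L.neg_mem h, ?_⟩
    have := φ.map_neg ⟨a, h⟩
    simp only at e
    rw [e] at this
    exact this

theorem mem_graphSubgroup {L : AddSubgroup A} {K : AddSubgroup B} {φ : L →+ B ⧸ K} {a : A} {b : B} :
    (a, b) ∈ graphSubgroup L K φ ↔ ∃ h : a ∈ L, φ ⟨a, h⟩ = (b : B ⧸ K) :=
  Iff.rfl

theorem graphSubgroup_bijective :
    Function.Bijective (fun t : Σ L : AddSubgroup A, Σ K : AddSubgroup B, (L →+ B ⧸ K) ↦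
      graphSubgroup t.1 t.2.1 t.2.2) := by
  constructor
  · rintro ⟨L, K, φ⟩ ⟨L', K', φ'⟩ h
    have h : ∀ (a : A) (b : B), (∃ h : a ∈ L, φ ⟨a, h⟩ = (b : B ⧸ K)) ↔
        ∃ h : a ∈ L', φ' ⟨a, h⟩ = (b : B ⧸ K') := fun a b ↦ SetLike.ext_iff.mp h (a, b)
    obtain rfl : L = L' := by
      ext a
      constructor
      · intro ha
        obtain ⟨b, hb⟩ := QuotientAddGroup.mk_surjective (φ ⟨a, ha⟩)
        exact ((h a b).1 ⟨ha, hb.symm⟩).1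
      · intro ha
        obtain ⟨b, hb⟩ := QuotientAddGroup.mk_surjective (φ' ⟨a, ha⟩)
        exact ((h a b).2 ⟨ha, hb.symm⟩).1
    obtain rfl : K = K' := by
      ext b
      have h0 : φ ⟨0, L.zero_mem⟩ = 0 := φ.map_zero
      have h0' : φ' ⟨0, L.zero_mem⟩ = 0 := φ'.map_zero
      have := h 0 b
      simp only [L.zero_mem, exists_true_left, h0, h0', eq_comm (a := (0 : B ⧸ _)),
        QuotientAddGroup.eq_zero_iff] at this
      exact this
    obtain rfl : φ = φ' := by
      ext ⟨a, ha⟩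
      obtain ⟨b, hb⟩ := QuotientAddGroup.mk_surjective (φ ⟨a, ha⟩)
      obtain ⟨_, h2⟩ := (h a b).1 ⟨ha, hb.symm⟩
      rw [← hb, h2]
    rfl
  · intro H
    -- `φ a` is the class of any `b` with `(a, b) ∈ H`; by `key` it does not depend on the choice.
    have ex : ∀ a : H.map (AddMonoidHom.fst A B), ∃ b, ((a : A), b) ∈ H := by
      rintro ⟨a, ⟨⟨a', b⟩, hz, rfl⟩⟩
      exact ⟨b, hz⟩
    choose f hf using ex
    have key : ∀ {a : A} {b b' : B}, (a, b) ∈ H → (a, b') ∈ H →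
        (b : B ⧸ H.comap (AddMonoidHom.inr A B)) = b' := by
      intro a b b' h h'
      rw [QuotientAddGroup.eq, AddSubgroup.mem_comap]
      simpa using H.add_mem (H.neg_mem h) h'
    refine ⟨⟨H.map (AddMonoidHom.fst A B), H.comap (AddMonoidHom.inr A B),
      AddMonoidHom.mk' (fun a ↦ (f a : B ⧸ H.comap (AddMonoidHom.inr A B))) ?_⟩, ?_⟩
    · intro a a'
      rw [← QuotientAddGroup.mk_add]
      exact key (hf _) (H.add_mem (hf a) (hf a'))
    · ext ⟨a, b⟩
      simp only [mem_graphSubgroup, AddMonoidHom.mk'_apply]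
      constructor
      · rintro ⟨h, e⟩
        rw [QuotientAddGroup.eq, AddSubgroup.mem_comap] at e
        simpa using H.add_mem (hf ⟨a, h⟩) e
      · intro h
        exact ⟨⟨(a, b), h, rfl⟩, key (hf _) h⟩

theorem card_addSubgroup_prod [Finite A] [Finite B]
    [Fintype (AddSubgroup A)] [Fintype (AddSubgroup B)] :
    Nat.card (AddSubgroup (A × B)) =
      ∑ K : AddSubgroup B, ∑ L : AddSubgroup A, Nat.card (L →+ B ⧸ K) := by
  have (L : AddSubgroup A) (K : AddSubgroup B) : Finite (L →+ B ⧸ K) := DFunLike.finite _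
  rw [← Nat.card_congr (Equiv.ofBijective _ (graphSubgroup_bijective (A := A) (B := B))),
    Nat.card_sigma, Finset.sum_comm]
  exact Finset.sum_congr rfl fun L _ ↦ Nat.card_sigma

end Goursat

/-! ### Homomorphisms into a cyclic group -/

/-- The character group of `L` is isomorphic to `L`, and the homomorphisms from `L` to a cyclic
group of order `n` are the characters killed by `n`. -/
theorem card_addMonoidHom_of_isAddCyclic {L C : Type*} [AddCommGroup L] [Finite L]
    [AddCommGroup C] [Finite C] [IsAddCyclic C] :
    Nat.card (L →+ C) = Nat.card (nTorsion L (Nat.card C)) := by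
  set n := Nat.card C with hn
  have : NeZero n := ⟨Nat.card_pos.ne'⟩
  obtain ⟨e⟩ : Nonempty (C ≃+ Additive (rootsOfUnity n ℂ)) :=
    ⟨addEquivOfAddCyclicCardEq (by
      rw [Nat.card_congr Additive.toMul, Complex.card_rootsOfUnity])⟩
  obtain ⟨d⟩ := CommGroup.monoidHom_mulEquiv_of_hasEnoughRootsOfUnity (Multiplicative L) ℂ
  let e₁ : (L →+ C) ≃ (Multiplicative L →* rootsOfUnity n ℂ) :=
    { toFun f :=
        { toFun x := (e (f x.toAdd)).toMul
          map_one' := by simp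
          map_mul' := by simp }
      invFun g :=
        { toFun x := e.symm (Additive.ofMul (g (Multiplicative.ofAdd x)))
          map_zero' := by simp
          map_add' := by simp }
      left_inv f := by ext; simp
      right_inv g := by ext; simp }
  let e₂ : (Multiplicative L →* rootsOfUnity n ℂ) ≃ {χ : Multiplicative L →* ℂˣ // χ ^ n = 1} :=
    { toFun f := ⟨(rootsOfUnity n ℂ).subtype.comp f, by
        ext x
        have := (mem_rootsOfUnity _ _).1 (f x).2
        exact congrArg Units.val this⟩
      invFun χ := χ.1.codRestrict _ fun x ↦ by
        rw [mem_rootsOfUnity, ← MonoidHom.pow_apply, χ.2, MonoidHom.one_apply]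
      left_inv f := by ext; simp
      right_inv χ := by ext; simp }
  let e₃ : {χ : Multiplicative L →* ℂˣ // χ ^ n = 1} ≃ nTorsion L n :=
    (d.toEquiv.trans Multiplicative.toAdd).subtypeEquiv fun χ ↦ by
      rw [mem_nTorsion, Equiv.trans_apply, ← toAdd_pow, ← d.map_eq_one_iff, map_pow]
      rfl
  exact Nat.card_congr ((e₁.trans e₂).trans e₃)

/-! ### Cyclic subgroups -/

section Cyclic

variable {A : Type*} [AddCommGroup A]

/-- The number of cyclic subgroups of order `d`. -/
noncomputable def cyclicCount (A : Type*) [AddCommGroup A] (d : ℕ) : ℕ :=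
  Nat.card {L : AddSubgroup A // IsAddCyclic L ∧ Nat.card L = d}

/-- Every element of order `d` generates a cyclic subgroup of order `d`, and each of these has
`φ d` generators. -/
theorem cyclicCount_mul_totient [Finite A] (d : ℕ) :
    cyclicCount A d * d.totient = Nat.card {x : A // addOrderOf x = d} := by
  classical
  have := Fintype.ofFinite A
  have := Fintype.ofFinite {L : AddSubgroup A // IsAddCyclic L ∧ Nat.card L = d}
  let g : {x : A // addOrderOf x = d} → {L : AddSubgroup A // IsAddCyclic L ∧ Nat.card L = d} :=
    fun x ↦ ⟨AddSubgroup.zmultiples x.1, inferInstance, by rw [Nat.card_zmultiples, x.2]⟩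
  rw [← Nat.card_congr (Equiv.sigmaFiberEquiv g), Nat.card_sigma,
    Finset.sum_congr rfl (g := fun _ ↦ d.totient), cyclicCount, Nat.card_eq_fintype_card]
  · simp
  · rintro ⟨L, hL, hd⟩ -
    have := Fintype.ofFinite L
    rw [← IsAddCyclic.card_addOrderOf_eq_totient (α := L) (d := d)
      (by rw [← hd, Nat.card_eq_fintype_card]), ← Fintype.card_subtype, ← Nat.card_eq_fintype_card]
    refine Nat.card_congr
      { toFun x := ⟨⟨x.1.1, ?_⟩, ?_⟩
        invFun y := ⟨⟨y.1.1, ?_⟩, ?_⟩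
        left_inv x := rfl
        right_inv y := rfl }
    · have := congrArg Subtype.val x.2
      simp only [g] at this
      exact (SetLike.ext_iff.1 this _).1 (AddSubgroup.mem_zmultiples x.1.1)
    · rw [AddSubgroup.addOrderOf_mk]
      exact x.1.2
    · rw [AddSubgroup.addOrderOf_coe]
      exact y.2
    · refine Subtype.ext (AddSubgroup.eq_of_le_of_card_ge ?_ ?_)
      · simp [g]
      · rw [hd]
        simp only [g]
        rw [Nat.card_zmultiples, AddSubgroup.addOrderOf_coe, y.2]

theorem cyclicCount_one [Finite A] : cyclicCount A 1 = 1 := by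
  have := cyclicCount_mul_totient (A := A) 1
  simpa using this

/-- The elements killed by `p ^ (m + 1)` are those of order `p ^ (m + 1)` and those killed by
`p ^ m`. -/
theorem cyclicCount_prime_pow [Finite A] {p : ℕ} (hp : p.Prime) (m : ℕ) :
    cyclicCount A (p ^ (m + 1)) * (p ^ m * (p - 1)) + Nat.card (nTorsion A (p ^ m)) =
      Nat.card (nTorsion A (p ^ (m + 1))) := by
  have := Fact.mk hp
  rw [← Nat.totient_prime_pow_succ hp, cyclicCount_mul_totient]
  have e : ∀ x : A, x ∈ nTorsion A (p ^ (m + 1)) ↔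
      addOrderOf x = p ^ (m + 1) ∨ x ∈ nTorsion A (p ^ m) := by
    intro x
    simp only [mem_nTorsion, ← addOrderOf_dvd_iff_nsmul_eq_zero, Nat.dvd_prime_pow hp]
    constructor
    · rintro ⟨k, hk, h⟩
      rcases hk.lt_or_eq with hk | rfl
      · exact Or.inr ⟨k, by omega, h⟩
      · exact Or.inl h
    · rintro (h | ⟨k, hk, h⟩)
      · exact ⟨_, le_rfl, h⟩
      · exact ⟨k, by omega, h⟩
  have e' : {x : A | addOrderOf x = p ^ (m + 1)} ∪ nTorsion A (p ^ m) =
      nTorsion A (p ^ (m + 1)) := by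
    ext x
    exact (e x).symm
  have hd : Disjoint {x : A | addOrderOf x = p ^ (m + 1)} (nTorsion A (p ^ m)) := by
    rw [Set.disjoint_left]
    intro x hx hx'
    have hx : addOrderOf x = p ^ (m + 1) := hx
    rw [SetLike.mem_coe, mem_nTorsion, ← addOrderOf_dvd_iff_nsmul_eq_zero, hx,
      Nat.pow_dvd_pow_iff_le_right hp.one_lt] at hx'
    omega
  have := Set.ncard_union_eq hd (Set.toFinite _) (Set.toFinite _)
  rw [e'] at this
  exact this.symm

open Classical in
theorem sum_isAddCyclic [Finite A] [Fintype (AddSubgroup A)] {p a : ℕ} (hp : p.Prime)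
    (hA : ∀ x : A, p ^ a • x = 0) (f : ℕ → ℕ) :
    ∑ L ∈ Finset.univ.filter (fun L : AddSubgroup A ↦ IsAddCyclic L), f (Nat.card L) =
      ∑ m ∈ Finset.range (a + 1), cyclicCount A (p ^ m) * f (p ^ m) := by
  rw [← Finset.sum_fiberwise_of_maps_to (t := (Finset.range (a + 1)).image (p ^ ·))
    (g := fun L : AddSubgroup A ↦ Nat.card L),
    Finset.sum_image fun _ _ _ _ h ↦ Nat.pow_right_injective hp.two_le h]
  · refine Finset.sum_congr rfl fun m _ ↦ ?_
    rw [Finset.sum_congr rfl (g := fun _ ↦ f (p ^ m)) fun L hL ↦ by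
      rw [(Finset.mem_filter.1 hL).2], Finset.sum_const, smul_eq_mul, cyclicCount,
      Finset.filter_filter, Nat.card_eq_fintype_card, Fintype.card_subtype]
  · intro L hL
    have : IsAddCyclic L := (Finset.mem_filter.1 hL).2
    obtain ⟨x, hx⟩ := IsAddCyclic.exists_generator (α := L)
    obtain ⟨k, hk, h⟩ := (Nat.dvd_prime_pow hp).1 (addOrderOf_dvd_of_nsmul_eq_zero
      (Subtype.ext (by simpa using hA x.1) : p ^ a • x = 0))
    rw [addOrderOf_eq_card_of_forall_mem_zmultiples hx] at h
    exact Finset.mem_image.2 ⟨k, Finset.mem_range.2 (by omega), h.symm⟩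

theorem card_nTorsion_zmod (n k : ℕ) [NeZero n] : Nat.card (nTorsion (ZMod n) k) = n.gcd k := by
  rw [IsAddCyclic.card_nsmulAddMonoidHom_ker, Nat.card_zmod]

theorem cyclicCount_zmod {p c m : ℕ} (hp : p.Prime) (hm : m ≤ c) :
    cyclicCount (ZMod (p ^ c)) (p ^ m) = 1 := by
  have : NeZero (p ^ c) := ⟨(pow_pos hp.pos c).ne'⟩
  cases m with
  | zero => exact cyclicCount_one
  | succ m =>
    have h := cyclicCount_prime_pow (A := ZMod (p ^ c)) hp m
    rw [card_nTorsion_zmod, card_nTorsion_zmod, Nat.gcd_eq_right (pow_dvd_pow _ hm),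
      Nat.gcd_eq_right (pow_dvd_pow _ (by omega))] at h
    obtain ⟨q, rfl⟩ : ∃ q, p = q + 2 := ⟨p - 2, by have := hp.two_le; omega⟩
    have h0 : 0 < (q + 2) ^ m * (q + 1) := by positivity
    refine Nat.eq_of_mul_eq_mul_right h0 ?_
    have : (q + 2) ^ (m + 1) = (q + 2) ^ m * (q + 1) + (q + 2) ^ m := by ring
    simp only [show q + 2 - 1 = q + 1 from rfl] at h
    omega

/-- The subgroups of a cyclic group of order `p ^ c` have orders `1, p, …, p ^ c`, one of each. -/
theorem sum_addSubgroup_zmod {p c : ℕ} (hp : p.Prime) [Fintype (AddSubgroup (ZMod (p ^ c)))]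
    (f : ℕ → ℕ) :
    ∑ K : AddSubgroup (ZMod (p ^ c)), f (Nat.card K) = ∑ m ∈ Finset.range (c + 1), f (p ^ m) := by
  classical
  have : NeZero (p ^ c) := ⟨(pow_pos hp.pos c).ne'⟩
  have h := sum_isAddCyclic (A := ZMod (p ^ c)) (a := c) hp (fun x ↦ by
    rw [nsmul_eq_mul, ZMod.natCast_self, zero_mul]) f
  rw [Finset.filter_true_of_mem fun (K : AddSubgroup _) _ ↦ (inferInstance : IsAddCyclic K)] at h
  rw [h]
  refine Finset.sum_congr rfl fun m hm ↦ ?_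
  rw [cyclicCount_zmod hp (by simpa [Nat.lt_succ_iff] using hm), one_mul]

end Cyclic

/-! ### The torsion sum over all subgroups -/

section TorsionSum

variable {A B : Type*} [AddCommGroup A] [AddCommGroup B]

/-- The sum over all subgroups `L` of `A` of the number of elements of `L` killed by `n`. It is a
`finsum`, meaningful when `A` has finitely many subgroups. -/
noncomputable def torsionSum (A : Type*) [AddCommGroup A] (n : ℕ) : ℕ :=
  ∑ᶠ L : AddSubgroup A, Nat.card (nTorsion L n)

theorem torsionSum_eq_sum (A : Type*) [AddCommGroup A] [Fintype (AddSubgroup A)] (n : ℕ) :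
    torsionSum A n = ∑ L : AddSubgroup A, Nat.card (nTorsion L n) :=
  finsum_eq_sum_of_fintype _

theorem card_nTorsion_coe (L : AddSubgroup A) (n : ℕ) :
    Nat.card (nTorsion L n) = Nat.card (L ⊓ nTorsion A n : AddSubgroup A) := by
  refine Nat.card_congr
    { toFun x := ⟨x.1.1, x.1.2, ?_⟩
      invFun x := ⟨⟨x.1, x.2.1⟩, ?_⟩
      left_inv x := rfl
      right_inv x := rfl }
  · have := mem_nTorsion.1 x.2
    exact mem_nTorsion.2 (by simpa using congrArg Subtype.val this)
  · have := mem_nTorsion.1 x.2.2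
    exact mem_nTorsion.2 (Subtype.ext (by simpa using this))

theorem card_comap_eq_card_ker_mul (f : A →+ B) (S : AddSubgroup B) :
    Nat.card (S.comap f) = Nat.card f.ker * Nat.card ((S.comap f).map f) := by
  have h := AddSubgroup.relIndex_mul_relIndex ⊥ f.ker (S.comap f) bot_le
    (by rw [← AddMonoidHom.comap_bot]; exact AddSubgroup.comap_mono bot_le)
  rw [AddSubgroup.relIndex_bot_left, AddSubgroup.relIndex_bot_left, ← AddMonoidHom.comap_bot,
    AddSubgroup.relIndex_comap, AddSubgroup.relIndex_bot_left] at h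
  rw [← h, ← AddMonoidHom.comap_bot]

/-- Multiplication by `p` maps `A[p ^ (k + 1)]` to `A[p ^ k]` with kernel `A[p]`. -/
theorem card_nTorsion_prime_pow_le [Finite A] {p : ℕ} (h : Nat.card (nTorsion A p) ≤ p) (k : ℕ) :
    Nat.card (nTorsion A (p ^ k)) ≤ p ^ k := by
  induction k with
  | zero =>
    simp
  | succ k ih =>
    have : nTorsion A (p ^ (k + 1)) = (nTorsion A (p ^ k)).comap (nsmulAddMonoidHom p) := by
      ext x
      simp [pow_succ, mul_smul]
    rw [this, card_comap_eq_card_ker_mul, pow_succ, mul_comm]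
    gcongr
    exact (Nat.card_mono (Set.toFinite _) (AddSubgroup.map_comap_le _ _)).trans ih

/-- A finite abelian `p`-group with at most `p` elements killed by `p` is cyclic. -/
theorem isAddCyclic_of_card_nTorsion_le [Finite A] {p a : ℕ} (hp : p.Prime)
    (hA : ∀ x : A, p ^ a • x = 0) (h : Nat.card (nTorsion A p) ≤ p) : IsAddCyclic A := by
  classical
  have := Fintype.ofFinite A
  refine isAddCyclic_of_card_nsmul_eq_zero_le fun n hn ↦ ?_
  -- An element killed by `n` is killed by the `p`-power `gcd (p ^ a) n`.
  obtain ⟨k, hk, hg⟩ := (Nat.dvd_prime_pow hp).1 (Nat.gcd_dvd_left (p ^ a) n)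
  calc _ ≤ Nat.card (nTorsion A (p ^ k)) := by
        rw [← Fintype.card_subtype, ← Nat.card_eq_fintype_card]
        refine Nat.card_mono (Set.toFinite _) fun x hx ↦ ?_
        rw [SetLike.mem_coe, mem_nTorsion, ← addOrderOf_dvd_iff_nsmul_eq_zero, ← hg]
        exact Nat.dvd_gcd (addOrderOf_dvd_of_nsmul_eq_zero (hA x))
          (addOrderOf_dvd_of_nsmul_eq_zero hx)
    _ ≤ p ^ k := card_nTorsion_prime_pow_le h k
    _ ≤ n := hg ▸ Nat.le_of_dvd hn (Nat.gcd_dvd_right _ _)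

theorem isAddCyclic_iff_not_nTorsion_le [Finite A] {p a : ℕ} (hp : p.Prime)
    (hA : ∀ x : A, p ^ a • x = 0) (h : Nat.card (nTorsion A p) = p ^ 2) (L : AddSubgroup A) :
    IsAddCyclic L ↔ ¬ nTorsion A p ≤ L := by
  constructor
  · intro hL hle
    have h1 : Nat.card (nTorsion L p) ≤ p := by
      rw [IsAddCyclic.card_nsmulAddMonoidHom_ker]
      exact Nat.le_of_dvd hp.pos (Nat.gcd_dvd_right _ _)
    rw [card_nTorsion_coe, inf_eq_right.2 hle, h] at h1
    nlinarith [hp.two_le]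
  · intro hle
    refine isAddCyclic_of_card_nTorsion_le hp (a := a)
      (fun x ↦ Subtype.ext (by simpa using hA x)) ?_
    have hd : Nat.card (L ⊓ nTorsion A p : AddSubgroup A) ∣ p ^ 2 :=
      h ▸ AddSubgroup.card_dvd_of_le inf_le_right
    obtain ⟨k, hk, hk'⟩ := (Nat.dvd_prime_pow hp).1 hd
    rw [card_nTorsion_coe, hk']
    have : k ≠ 2 := by
      rintro rfl
      exact hle (inf_eq_right.1
        (AddSubgroup.eq_of_le_of_card_ge inf_le_right (by rw [hk', h])))
    calc p ^ k ≤ p ^ 1 := Nat.pow_le_pow_right hp.pos (by omega)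
      _ = p := pow_one p

open Classical in
/-- Subgroups containing the kernel of a surjection are the preimages of the subgroups of the
target. -/
theorem sum_ker_le {q : A →+ B} (hq : Function.Surjective q) [Fintype (AddSubgroup A)]
    [Fintype (AddSubgroup B)] (F : AddSubgroup A → ℕ) :
    ∑ L : AddSubgroup A with q.ker ≤ L, F L = ∑ L : AddSubgroup B, F (L.comap q) := by
  refine Finset.sum_nbij' (fun L ↦ L.map q) (fun L ↦ L.comap q) (by simp) ?_ ?_ ?_ ?_
  · intro L _
    simp only [Finset.mem_filter, Finset.mem_univ, true_and]
    rw [← AddMonoidHom.comap_bot]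
    exact AddSubgroup.comap_mono bot_le
  · intro L hL
    exact AddSubgroup.comap_map_eq_self (Finset.mem_filter.1 hL).2
  · intro L _
    exact AddSubgroup.map_comap_eq_self_of_surjective hq L
  · intro L hL
    rw [AddSubgroup.comap_map_eq_self (Finset.mem_filter.1 hL).2]

/-- The elements of `q ⁻¹ L` killed by `p * n` are the preimages of the elements of `L` killed by `n`,
and all fibres of `q` have the size of `A[p]`. -/
theorem card_nTorsion_comap {q : A →+ B} (hq : Function.Surjective q) {p : ℕ}
    (hk : q.ker = nTorsion A p) (L : AddSubgroup B) (n : ℕ) :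
    Nat.card (nTorsion (L.comap q) (p * n)) =
      Nat.card (nTorsion A p) * Nat.card (nTorsion L n) := by
  have : L.comap q ⊓ nTorsion A (p * n) = (L ⊓ nTorsion B n).comap q := by
    ext x
    rw [AddSubgroup.comap_inf, AddSubgroup.mem_inf, AddSubgroup.mem_inf, AddSubgroup.mem_comap,
      AddSubgroup.mem_comap, mem_nTorsion, mem_nTorsion, ← map_nsmul, ← AddMonoidHom.mem_ker, hk,
      mem_nTorsion, mul_smul]
  rw [card_nTorsion_coe, this, card_comap_eq_card_ker_mul,
    AddSubgroup.map_comap_eq_self_of_surjective hq, hk, card_nTorsion_coe L]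

theorem card_nTorsion_one (A : Type*) [AddCommGroup A] : Nat.card (nTorsion A 1) = 1 := by
  have : nTorsion A 1 = ⊥ := by
    ext x
    simp
  simp [this]

/-- The contribution to `torsionSum A n` of the cyclic subgroups of order `p ^ m`, `m ≤ a`: a cyclic
group of order `d` has `gcd d n` elements killed by `n`. If `p ^ a` kills `A`, these are all the
cyclic subgroups (`sum_isAddCyclic_card_nTorsion`). -/
noncomputable def cyclicTorsionSum (A : Type*) [AddCommGroup A] (p a n : ℕ) : ℕ :=
  ∑ m ∈ Finset.range (a + 1), cyclicCount A (p ^ m) * (p ^ m).gcd n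

open Classical in
theorem sum_isAddCyclic_card_nTorsion [Finite A] [Fintype (AddSubgroup A)] {p a : ℕ} (hp : p.Prime)
    (hA : ∀ x : A, p ^ a • x = 0) (n : ℕ) :
    ∑ L ∈ Finset.univ.filter (fun L : AddSubgroup A ↦ IsAddCyclic L), Nat.card (nTorsion L n) =
      cyclicTorsionSum A p a n := by
  rw [cyclicTorsionSum, ← sum_isAddCyclic hp hA fun d ↦ d.gcd n]
  refine Finset.sum_congr rfl fun L hL ↦ ?_
  have := (Finset.mem_filter.1 hL).2
  exact IsAddCyclic.card_nsmulAddMonoidHom_ker L n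

/-- In a `p`-group `A` of rank two a subgroup is either cyclic or contains all elements killed
by `p`; the latter subgroups are the preimages of the subgroups of `B = A / A[p]`. -/
theorem torsionSum_prime_mul [Finite A] [Finite B]
    {p a : ℕ} (hp : p.Prime) (hA : ∀ x : A, p ^ a • x = 0) (h : Nat.card (nTorsion A p) = p ^ 2)
    {q : A →+ B} (hq : Function.Surjective q) (hk : q.ker = nTorsion A p) (n : ℕ) :
    torsionSum A (p * n) = cyclicTorsionSum A p a (p * n) + p ^ 2 * torsionSum B n := by
  classical
  have := Fintype.ofFinite (AddSubgroup A)
  have := Fintype.ofFinite (AddSubgroup B)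
  rw [torsionSum_eq_sum, ← Finset.sum_filter_add_sum_filter_not _ (fun L : AddSubgroup A ↦ IsAddCyclic L),
    sum_isAddCyclic_card_nTorsion hp hA]
  simp only [isAddCyclic_iff_not_nTorsion_le hp hA h, not_not, ← hk]
  rw [sum_ker_le hq, torsionSum_eq_sum, Finset.mul_sum]
  simp only [card_nTorsion_comap hq hk, h]

/-- The analogue of `torsionSum_prime_mul` for `n = 1`, where `torsionSum` counts subgroups. -/
theorem torsionSum_one [Finite A] [Finite B]
    {p a : ℕ} (hp : p.Prime) (hA : ∀ x : A, p ^ a • x = 0) (h : Nat.card (nTorsion A p) = p ^ 2)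
    {q : A →+ B} (hq : Function.Surjective q) (hk : q.ker = nTorsion A p) :
    torsionSum A 1 = cyclicTorsionSum A p a 1 + torsionSum B 1 := by
  classical
  have := Fintype.ofFinite (AddSubgroup A)
  have := Fintype.ofFinite (AddSubgroup B)
  rw [torsionSum_eq_sum, ← Finset.sum_filter_add_sum_filter_not _ (fun L : AddSubgroup A ↦ IsAddCyclic L),
    sum_isAddCyclic_card_nTorsion hp hA]
  simp only [isAddCyclic_iff_not_nTorsion_le hp hA h, not_not, ← hk]
  rw [sum_ker_le hq, torsionSum_eq_sum]
  simp only [card_nTorsion_one]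

theorem torsionSum_of_isAddCyclic [Finite A] [IsAddCyclic A] {p a : ℕ}
    (hp : p.Prime) (hA : ∀ x : A, p ^ a • x = 0) (n : ℕ) :
    torsionSum A n = cyclicTorsionSum A p a n := by
  classical
  have := Fintype.ofFinite (AddSubgroup A)
  rw [torsionSum_eq_sum, ← sum_isAddCyclic_card_nTorsion hp hA,
    Finset.filter_true_of_mem fun (K : AddSubgroup _) _ ↦ (inferInstance : IsAddCyclic K)]

/-- Summing over the subgroups of the cyclic factor: the quotient by the subgroup of order
`p ^ (c - j)` is cyclic of order `p ^ j`. -/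
theorem card_addSubgroup_prod_zmod [Finite A] {p : ℕ} (hp : p.Prime)
    (c : ℕ) :
    Nat.card (AddSubgroup (A × ZMod (p ^ c))) =
      ∑ j ∈ Finset.range (c + 1), torsionSum A (p ^ j) := by
  have : NeZero (p ^ c) := ⟨(pow_pos hp.pos c).ne'⟩
  have := Fintype.ofFinite (AddSubgroup A)
  have := Fintype.ofFinite (AddSubgroup (ZMod (p ^ c)))
  have hK (K : AddSubgroup (ZMod (p ^ c))) :
      ∑ L : AddSubgroup A, Nat.card (L →+ ZMod (p ^ c) ⧸ K) =
        torsionSum A (p ^ c / Nat.card K) := by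
    have : IsAddCyclic (ZMod (p ^ c) ⧸ K) :=
      isAddCyclic_of_surjective _ (QuotientAddGroup.mk'_surjective K)
    have hc : Nat.card (ZMod (p ^ c) ⧸ K) = p ^ c / Nat.card K := by
      have h := AddSubgroup.card_mul_index K
      rw [Nat.card_zmod] at h
      exact (Nat.div_eq_of_eq_mul_right Nat.card_pos h.symm).symm
    rw [torsionSum_eq_sum, ← hc]
    exact Finset.sum_congr rfl fun L _ ↦ card_addMonoidHom_of_isAddCyclic
  rw [card_addSubgroup_prod, Finset.sum_congr rfl fun K _ ↦ hK K,
    sum_addSubgroup_zmod hp fun d ↦ torsionSum A (p ^ c / d), ← Finset.sum_range_reflect]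
  refine Finset.sum_congr rfl fun j hj ↦ ?_
  have hj := Finset.mem_range.1 hj
  rw [Nat.pow_div (by omega) hp.pos]
  congr 2
  omega

end TorsionSum

/-! ### The rank two group -/

section RankTwo

theorem card_nTorsion_prod (A B : Type*) [AddCommGroup A] [AddCommGroup B] (n : ℕ) :
    Nat.card (nTorsion (A × B) n) = Nat.card (nTorsion A n) * Nat.card (nTorsion B n) := by
  have : nTorsion (A × B) n = (nTorsion A n).prod (nTorsion B n) := by
    ext ⟨x, y⟩
    simp [AddSubgroup.mem_prod]
  rw [this, Nat.card_congr (AddSubgroup.prodEquiv _ _).toEquiv, Nat.card_prod]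

/-- The group `ℤ/pᵃ × ℤ/pᵇ`. -/
abbrev RankTwo (p a b : ℕ) : Type := ZMod (p ^ a) × ZMod (p ^ b)

variable {p : ℕ}

theorem RankTwo.finite (hp : p.Prime) (a b : ℕ) : Finite (RankTwo p a b) := by
  have (n : ℕ) : NeZero (p ^ n) := ⟨(pow_pos hp.pos n).ne'⟩
  infer_instance

theorem card_nTorsion_rankTwo (hp : p.Prime) (a b m : ℕ) :
    Nat.card (nTorsion (RankTwo p a b) (p ^ m)) = p ^ (min a m + min b m) := by
  have (n : ℕ) : NeZero (p ^ n) := ⟨(pow_pos hp.pos n).ne'⟩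
  have h (x y : ℕ) : (p ^ x).gcd (p ^ y) = p ^ min x y := by
    rcases le_total x y with h | h
    · rw [min_eq_left h, Nat.gcd_eq_left (pow_dvd_pow p h)]
    · rw [min_eq_right h, Nat.gcd_eq_right (pow_dvd_pow p h)]
  rw [card_nTorsion_prod, card_nTorsion_zmod, card_nTorsion_zmod, h, h, pow_add]

theorem pow_nsmul_rankTwo {a b : ℕ} (hab : b ≤ a) (x : RankTwo p a b) : p ^ a • x = 0 := by
  have h (n : ℕ) (hn : n ≤ a) (y : ZMod (p ^ n)) : p ^ a • y = 0 := by
    rw [nsmul_eq_mul, (ZMod.natCast_eq_zero_iff _ _).2 (pow_dvd_pow p hn), zero_mul]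
  exact Prod.ext (h a le_rfl x.1) (h b hab x.2)

/-- Reduction of both coordinates, `ℤ/pᵃ⁺¹ × ℤ/pᵇ⁺¹ → ℤ/pᵃ × ℤ/pᵇ`. -/
def RankTwo.reduce (p a b : ℕ) : RankTwo p (a + 1) (b + 1) →+ RankTwo p a b :=
  AddMonoidHom.prodMap
    (ZMod.castHom (pow_dvd_pow p a.le_succ) (ZMod (p ^ a))).toAddMonoidHom
    (ZMod.castHom (pow_dvd_pow p b.le_succ) (ZMod (p ^ b))).toAddMonoidHom

theorem RankTwo.reduce_surjective (p a b : ℕ) : Function.Surjective (RankTwo.reduce p a b) :=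
  Function.Surjective.prodMap (ZMod.castHom_surjective (pow_dvd_pow p a.le_succ))
    (ZMod.castHom_surjective (pow_dvd_pow p b.le_succ))

theorem RankTwo.ker_reduce (hp : p.Prime) (a b : ℕ) :
    (RankTwo.reduce p a b).ker = nTorsion (RankTwo p (a + 1) (b + 1)) p := by
  have h (n : ℕ) (x : ZMod (p ^ (n + 1))) :
      ZMod.castHom (pow_dvd_pow p n.le_succ) (ZMod (p ^ n)) x = 0 ↔ p • x = 0 := by
    have : NeZero (p ^ (n + 1)) := ⟨(pow_pos hp.pos _).ne'⟩
    obtain ⟨k, rfl⟩ := ZMod.natCast_zmod_surjective x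
    rw [map_natCast, nsmul_eq_mul, ← Nat.cast_mul, ZMod.natCast_eq_zero_iff,
      ZMod.natCast_eq_zero_iff, pow_succ', Nat.mul_dvd_mul_iff_left hp.pos]
  ext ⟨x, y⟩
  rw [mem_nTorsion, AddMonoidHom.mem_ker, Prod.smul_mk, Prod.mk_eq_zero (x := p • x), ← h, ← h]
  exact Prod.mk_eq_zero


theorem cyclicCount_rankTwo_of_lt (hp : p.Prime) {a b m : ℕ} (hab : b ≤ a) (hm : m < b) :
    (cyclicCount (RankTwo p a b) (p ^ (m + 1)) : ℚ) = (p : ℚ) ^ m * (p + 1) := by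
  have := RankTwo.finite hp a b
  have h := cyclicCount_prime_pow (A := RankTwo p a b) hp m
  rw [card_nTorsion_rankTwo hp, card_nTorsion_rankTwo hp, min_eq_right (by omega),
    min_eq_right (by omega), min_eq_right (by omega), min_eq_right (by omega)] at h
  have h : (_ : ℚ) = _ := congrArg Nat.cast h
  push_cast [Nat.cast_sub hp.one_le] at h
  have hx : (1 : ℚ) < p := by exact_mod_cast hp.one_lt
  have h0 : (p : ℚ) ^ m * (p - 1) ≠ 0 := by
    have : (p : ℚ) - 1 ≠ 0 := by linarith
    positivity
  refine mul_right_cancel₀ h0 ?_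
  linear_combination h

theorem cyclicCount_rankTwo_of_le (hp : p.Prime) {a b m : ℕ} (hbm : b ≤ m) (hm : m < a) :
    (cyclicCount (RankTwo p a b) (p ^ (m + 1)) : ℚ) = (p : ℚ) ^ b := by
  have := RankTwo.finite hp a b
  have h := cyclicCount_prime_pow (A := RankTwo p a b) hp m
  rw [card_nTorsion_rankTwo hp, card_nTorsion_rankTwo hp, min_eq_right (by omega),
    min_eq_left (by omega), min_eq_right (by omega), min_eq_left (by omega)] at h
  have h : (_ : ℚ) = _ := congrArg Nat.cast h
  push_cast [Nat.cast_sub hp.one_le] at h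
  have hx : (1 : ℚ) < p := by exact_mod_cast hp.one_lt
  have h0 : (p : ℚ) ^ m * (p - 1) ≠ 0 := by
    have : (p : ℚ) - 1 ≠ 0 := by linarith
    positivity
  refine mul_right_cancel₀ h0 ?_
  linear_combination h

theorem cyclicTorsionSum_succ {A : Type*} [AddCommGroup A] (n k : ℕ) :
    cyclicTorsionSum A p (n + 1) k =
      cyclicTorsionSum A p n k + cyclicCount A (p ^ (n + 1)) * (p ^ (n + 1)).gcd k :=
  Finset.sum_range_succ _ _

/-- The partial sum over `m ≤ n` has three regimes, according to the position of `n` relative to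
`j ≤ b ≤ a`; the value at the end of one regime starts the next. -/
theorem cyclicTorsionSum_rankTwo_of_le_left (hp : p.Prime) {a b j n : ℕ} (hab : b ≤ a)
    (hjb : j ≤ b) (hn : n ≤ j) :
    ((p : ℚ) - 1) * cyclicTorsionSum (RankTwo p a b) p n (p ^ j) = (p : ℚ) ^ (2 * n + 1) - 1 := by
  have := RankTwo.finite hp a b
  induction n with
  | zero => simp [cyclicTorsionSum, cyclicCount_one]
  | succ n ih =>
    rw [cyclicTorsionSum_succ, Nat.gcd_eq_left (pow_dvd_pow p hn), Nat.cast_add, Nat.cast_mul,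
      cyclicCount_rankTwo_of_lt hp hab (by omega), mul_add, ih (by omega)]
    push_cast
    ring

theorem cyclicTorsionSum_rankTwo_of_le_right (hp : p.Prime) {a b j n : ℕ} (hab : b ≤ a)
    (hjn : j ≤ n) (hn : n ≤ b) :
    ((p : ℚ) - 1) * cyclicTorsionSum (RankTwo p a b) p n (p ^ j) =
      (p : ℚ) ^ (2 * j + 1) - 1 + (p + 1) * ((p : ℚ) ^ (n + j) - (p : ℚ) ^ (2 * j)) := by
  induction n, hjn using Nat.le_induction with
  | base =>
    rw [cyclicTorsionSum_rankTwo_of_le_left hp hab hn le_rfl]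
    ring
  | succ n hjn ih =>
    rw [cyclicTorsionSum_succ, Nat.gcd_eq_right (pow_dvd_pow p (by omega)), Nat.cast_add,
      Nat.cast_mul, cyclicCount_rankTwo_of_lt hp hab (by omega), mul_add, ih (by omega)]
    push_cast
    ring

theorem cyclicTorsionSum_rankTwo (hp : p.Prime) {a b j n : ℕ} (hjb : j ≤ b)
    (hbn : b ≤ n) (hn : n ≤ a) :
    ((p : ℚ) - 1) * cyclicTorsionSum (RankTwo p a b) p n (p ^ j) =
      (p + 1) * (p : ℚ) ^ (b + j) - (p : ℚ) ^ (2 * j) - 1 +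
        ((n : ℚ) - b) * ((p : ℚ) - 1) * (p : ℚ) ^ (b + j) := by
  induction n, hbn using Nat.le_induction with
  | base =>
    rw [cyclicTorsionSum_rankTwo_of_le_right hp hn hjb le_rfl]
    ring
  | succ n hbn ih =>
    rw [cyclicTorsionSum_succ, Nat.gcd_eq_right (pow_dvd_pow p (by omega)), Nat.cast_add,
      Nat.cast_mul, cyclicCount_rankTwo_of_le hp hbn (by omega), mul_add, ih (by omega)]
    push_cast
    ring

/-- The right-hand side is the difference of the numerators of the subgroup count of
`ℤ/pᵃ × ℤ/pᵇ × ℤ/pᶜ` at `c = j` and `c = j - 1`; the numerator at `c = -1` is zero. -/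
theorem torsionSum_rankTwo (hp : p.Prime) {a b j : ℕ} (hab : b ≤ a) (hjb : j ≤ b) :
    (torsionSum (RankTwo p a b) (p ^ j) : ℚ) * (((p : ℚ) ^ 2 - 1) ^ 2 * ((p : ℚ) - 1)) =
      (p : ℚ) ^ (b + j) * (((j : ℚ) + 1) * p - j) *
          (((a : ℚ) - b + 1) * (p : ℚ) ^ 4 + 2 * (p : ℚ) ^ 3 - 2 * ((a : ℚ) - b) * (p : ℚ) ^ 2
            - 2 * p + ((a : ℚ) - b - 1))
        + (p : ℚ) ^ (2 * j) * (-((a : ℚ) + b - j + 3) * (p : ℚ) ^ 4 - 2 * (p : ℚ) ^ 3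
            + (2 * ((a : ℚ) + b - j) + 3) * (p : ℚ) ^ 2 + 2 * p - ((a : ℚ) + b - j))
        + (p : ℚ) ^ 2 - 1 := by
  induction b generalizing a j with
  | zero =>
    obtain rfl : j = 0 := by omega
    have := RankTwo.finite hp a 0
    have hcyc : IsAddCyclic (RankTwo p a 0) := by
      have : Subsingleton (ZMod (p ^ 0)) := by
        rw [pow_zero]
        infer_instance
      refine isAddCyclic_of_injective (AddMonoidHom.fst (ZMod (p ^ a)) (ZMod (p ^ 0))) ?_
      exact fun x y h ↦ Prod.ext h (Subsingleton.elim _ _)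
    have h := cyclicTorsionSum_rankTwo hp le_rfl a.zero_le (le_refl a)
    rw [torsionSum_of_isAddCyclic hp (pow_nsmul_rankTwo a.zero_le)]
    simp only [mul_zero, add_zero, pow_zero, Nat.cast_zero] at h ⊢
    linear_combination ((p : ℚ) ^ 2 - 1) ^ 2 * h
  | succ b ih =>
    obtain ⟨a, rfl⟩ : ∃ c, a = c + 1 := ⟨a - 1, by omega⟩
    have := RankTwo.finite hp a b
    have := RankTwo.finite hp (a + 1) (b + 1)
    have hcard : Nat.card (nTorsion (RankTwo p (a + 1) (b + 1)) p) = p ^ 2 := by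
      simpa using card_nTorsion_rankTwo hp (a + 1) (b + 1) 1
    have h := cyclicTorsionSum_rankTwo hp hjb hab le_rfl
    cases j with
    | zero =>
      have ih := ih (j := 0) (by omega : b ≤ a) b.zero_le
      rw [pow_zero] at h ih ⊢
      rw [torsionSum_one hp (pow_nsmul_rankTwo hab) hcard (RankTwo.reduce_surjective p a b)
        (RankTwo.ker_reduce hp a b)]
      push_cast at h ih ⊢
      linear_combination ((p : ℚ) ^ 2 - 1) ^ 2 * h + ih
    | succ j =>
      have ih := ih (j := j) (by omega : b ≤ a) (by omega)
      rw [pow_succ' p j] at h ⊢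
      rw [torsionSum_prime_mul hp (pow_nsmul_rankTwo hab) hcard (RankTwo.reduce_surjective p a b)
        (RankTwo.ker_reduce hp a b)]
      push_cast at h ih ⊢
      linear_combination ((p : ℚ) ^ 2 - 1) ^ 2 * h + (p : ℚ) ^ 2 * ih

end RankTwo

/-! ### The number of subgroups in rank three -/

theorem mainTheorem10 (p : ℕ) (hp : p.Prime) (l₁ l₂ l₃ : ℕ)
    (h₁₂ : l₂ ≤ l₁) (h₂₃ : l₃ ≤ l₂) (h₃ : 1 ≤ l₃) :
    (Nat.card (AddSubgroup (ZMod (p ^ l₁) × ZMod (p ^ l₂) × ZMod (p ^ l₃))) : ℚ) =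
      (((l₃ : ℚ) + 1) * ((l₁ : ℚ) - l₂ + 1) * (p : ℚ) ^ (l₂ + l₃ + 5)
        + 2 * ((l₃ : ℚ) + 1) * (p : ℚ) ^ (l₂ + l₃ + 4)
        - 2 * ((l₃ : ℚ) + 1) * ((l₁ : ℚ) - l₂) * (p : ℚ) ^ (l₂ + l₃ + 3)
        - 2 * ((l₃ : ℚ) + 1) * (p : ℚ) ^ (l₂ + l₃ + 2)
        + ((l₃ : ℚ) + 1) * ((l₁ : ℚ) - l₂ - 1) * (p : ℚ) ^ (l₂ + l₃ + 1)
        - ((l₁ : ℚ) + l₂ - l₃ + 3) * (p : ℚ) ^ (2 * l₃ + 4)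
        - 2 * (p : ℚ) ^ (2 * l₃ + 3)
        + ((l₁ : ℚ) + l₂ - l₃ - 1) * (p : ℚ) ^ (2 * l₃ + 2)
        + ((l₁ : ℚ) + l₂ + l₃ + 5) * (p : ℚ) ^ 2
        + 2 * (p : ℚ)
        - ((l₁ : ℚ) + l₂ + l₃ + 1))
      / (((p : ℚ) ^ 2 - 1) ^ 2 * ((p : ℚ) - 1)) := by
  have := RankTwo.finite hp l₁ l₂
  have hx : (1 : ℚ) < p := by exact_mod_cast hp.one_lt
  have hD : ((p : ℚ) ^ 2 - 1) ^ 2 * ((p : ℚ) - 1) ≠ 0 := by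
    have h1 : (p : ℚ) - 1 ≠ 0 := by linarith
    have h2 : (p : ℚ) ^ 2 - 1 ≠ 0 := by nlinarith
    positivity
  rw [eq_div_iff hD, ← Nat.card_congr (AddEquiv.mapAddSubgroup (AddEquiv.prodAssoc
      (M := ZMod (p ^ l₁)) (N := ZMod (p ^ l₂)) (P := ZMod (p ^ l₃)))).toEquiv,
    card_addSubgroup_prod_zmod hp]
  -- The formula also holds for `l₃ = 0`, so the induction starts there.
  clear h₃
  induction l₃ with
  | zero =>
    have h := torsionSum_rankTwo hp h₁₂ h₂₃
    rw [Finset.sum_range_one, h]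
    push_cast
    ring
  | succ c ih =>
    have h := torsionSum_rankTwo hp h₁₂ h₂₃
    rw [Finset.sum_range_succ, Nat.cast_add, add_mul, ih (by omega), h]
    push_cast
    ring
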